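/- **Expressions and NKA.** For an alphabet $\Sigma$, expressions over $\Sigma$ are given by $e ::= 0 \mid 1 \mid a \mid e_1+e_2 \mid e_1\cdot e_2 \mid e^*$ with $a\in\Sigma$. A Horn formula $(\bigwedge_{i}\varphi_i)\to\varphi$ with finitely many premises, where $\varphi_i,\varphi$ are equations or inequalities between expressions, is *derivable in NKA* ($\vdash_{\mathrm{NKA}}$) if $\varphi$ can be derived from the $\varphi_i$ by equational logic (equality is an equivalence relation and a congruence for $+,\cdot,{}^*,\le$) and the axioms of non-idempotent Kleene algebra, schematic in the expressions $p,q,r,s$: the semiring laws ($+$ associative and commutative with unit $0$; $\cdot$ associative with unit $1$; $0p=p0=0$; both distributive laws); the partial order laws ($p\le p$; $p\le q\wedge q\le p\to p=q$; $p\le q\wedge q\le r\to p\le r$; $p\le q\wedge r\le s\to p+r\le q+s$; $p\le q\wedge r\le s\to pr\le qs$); and the star laws ($1+pp^*\le p^*$; $q+pr\le r\to p^*q\le r$; $q+rp\le r\to qp^*\le r$). **Programs.** Let $V$ be a finite set of registers, register $v$ having dimension $d_v\ge 1$, and $\mathcal H=\bigotimes_{v\in V}\mathbb C^{d_v}$.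 Let $\mathcal{QC}(\mathcal H)$ be the set of completely positive, trace-non-increasing linear superoperators on $\mathcal H$. Quantum while-programs are $$P ::= \mathbf{skip}\mid\mathbf{abort}\mid q:=|0\rangle\mid \overline q:=U[\overline q]\mid P_1;P_2\mid \mathbf{case}\ M[\overline q]\xrightarrow{i}P_i\ \mathbf{end}\mid \mathbf{while}\ M[\overline q]=1\ \mathbf{do}\ P\ \mathbf{done},$$ where $q\in V$, $\overline q$ is a set of registers, $U$ is a unitary operator on the space of $\overline q$, and $M=\{M_i\}_i$ is a measurement on it with finitely many outcomes (outcomes $0,1$ for loops), i.e. $\sum_i M_i^\dagger M_i=I$. Operators on $\overline q$ act on $\mathcal H$ after tensoring with the identity on the other registers. Put $\mathcal M_i(\rho)=M_i\rho M_i^\dagger$ and $(\mathcal E_1\circ\mathcal E_2)(\rho)=\mathcal E_2(\mathcal E_1(\rho))$. The denotational semantics is $$[\![\mathbf{skip}]\!](\rho)=\rho,\quad [\![\mathbf{abort}]\!](\rho)=0,\quad [\![q:=|0\rangle]\!](\rho)=\sum_i|0\rangle_q\langle i|\rho|i\rangle_q\langle 0|,\quad [\![\overline q:=U[\overline q]]\!](\rho)=U_{\overline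 q}\,\rho\, U_{\overline q}^\dagger,$$ $$[\![P_1;P_2]\!]=[\![P_1]\!]\circ[\![P_2]\!],\quad [\![\mathbf{case}\ M[\overline q]\xrightarrow{i}P_i\ \mathbf{end}]\!]=\sum_i\mathcal M_i\circ[\![P_i]\!],\quad [\![\mathbf{while}\ M[\overline q]=1\ \mathbf{do}\ P\ \mathbf{done}]\!]=\sum_{n\ge0}(\mathcal M_1\circ[\![P]\!])^n\circ\mathcal M_0,$$ where an infinite sum $\sum_n\mathcal E_n$ denotes the $\mathcal E\in\mathcal{QC}(\mathcal H)$ with $\mathcal E(\rho)=\sum_n\mathcal E_n(\rho)$ for all positive semidefinite $\rho$. **Encoding.** An encoder setting is an injective map $E$ from a finite subset of $\mathcal{QC}(\mathcal H)$ to $\Sigma$; it covers a program if its domain contains all elementary superoperators of the program (those of its resets, unitaries, and measurement branches $\mathcal M_i$). For a covered program, $\mathrm{Enc}(\mathbf{skip})=1$, $\mathrm{Enc}(\mathbf{abort})=0$, $\mathrm{Enc}(P)=E([\![P]\!])$ if $P$ is a reset or a unitary statement, $\mathrm{Enc}(P_1;P_2)=\mathrm{Enc}(P_1)\cdot\mathrm{Enc}(P_2)$,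 $\mathrm{Enc}(\mathbf{case}\ M[\overline q]\xrightarrow{i}P_i\ \mathbf{end})=\sum_iE(\mathcal M_i)\cdot\mathrm{Enc}(P_i)$, and $\mathrm{Enc}(\mathbf{while}\ M[\overline q]=1\ \mathbf{do}\ P\ \mathbf{done})=(E(\mathcal M_1)\cdot\mathrm{Enc}(P))^*\cdot E(\mathcal M_0)$. **Theorem.** Let $P,Q$ and $P_1,Q_1,\dots,P_k,Q_k$ ($k\ge0$) be quantum while-programs over the same registers, all covered by one encoder setting $E$, with $[\![P_i]\!]=[\![Q_i]\!]$ for every $i$. If $$\vdash_{\mathrm{NKA}}\Big(\bigwedge_{i=1}^k\mathrm{Enc}(P_i)=\mathrm{Enc}(Q_i)\Big)\to\mathrm{Enc}(P)=\mathrm{Enc}(Q),$$ then $[\![P]\!]=[\![Q]\!]$. -/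

import Mathlib

namespace QuantumNKA

open scoped ComplexOrder Matrix

/-! ### Expressions, Horn formulae and derivability in NKA -/

/-- Expressions over an alphabet `α`: `e ::= 0 | 1 | a | e₁ + e₂ | e₁ · e₂ | e*`. -/
inductive Exp (α : Type*) where
  | zero : Exp α
  | one : Exp α
  | sym (a : α) : Exp α
  | add (e f : Exp α) : Exp α
  | mul (e f : Exp α) : Exp α
  | star (e : Exp α) : Exp α

/-- The expression `e₁ + (e₂ + (⋯ + eₖ))`; the empty sum is `0`. -/
def Exp.sum {α : Type*} : List (Exp α) → Exp α
  | [] => .zero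
  | [e] => e
  | e :: e' :: es => .add e (Exp.sum (e' :: es))

/-- Atomic formulae: equations and inequalities between expressions. -/
inductive Formula (α : Type*) where
  | eq (e f : Exp α) : Formula α
  | le (e f : Exp α) : Formula α

/-- A Horn formula `(⋀ᵢ φᵢ) → φ` with finitely many atomic premises. -/
structure HornFormula (α : Type*) where
  premises : List (Formula α)
  conclusion : Formula α

open Exp Formula in
/-- `Derives Γ φ`: the atomic formula `φ` is derivable from the premises `Γ` by the axioms of
non-idempotent Kleene algebra and the rules for equality (equivalence and congruence).
Letters of the alphabet are constants; the axioms are schematic in `p q r s`. -/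
inductive Derives {α : Type*} (Γ : List (Formula α)) : Formula α → Prop
  | hyp {φ : Formula α} : φ ∈ Γ → Derives Γ φ
  -- equational logic
  | eq_refl (p : Exp α) : Derives Γ (eq p p)
  | eq_symm {p q : Exp α} : Derives Γ (eq p q) → Derives Γ (eq q p)
  | eq_trans {p q r : Exp α} : Derives Γ (eq p q) → Derives Γ (eq q r) → Derives Γ (eq p r)
  | add_congr {p q r s : Exp α} : Derives Γ (eq p q) → Derives Γ (eq r s) →
      Derives Γ (eq (add p r) (add q s))
  | mul_congr {p q r s : Exp α} : Derives Γ (eq p q) → Derives Γ (eq r s) →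
      Derives Γ (eq (mul p r) (mul q s))
  | star_congr {p q : Exp α} : Derives Γ (eq p q) → Derives Γ (eq (star p) (star q))
  | le_congr {p q r s : Exp α} : Derives Γ (eq p q) → Derives Γ (eq r s) →
      Derives Γ (le p r) → Derives Γ (le q s)
  -- semiring laws
  | add_assoc (p q r : Exp α) : Derives Γ (eq (add p (add q r)) (add (add p q) r))
  | add_comm (p q : Exp α) : Derives Γ (eq (add p q) (add q p))
  | add_zero (p : Exp α) : Derives Γ (eq (add p zero) p)
  | mul_assoc (p q r : Exp α) : Derives Γ (eq (mul p (mul q r)) (mul (mul p q) r))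
  | one_mul (p : Exp α) : Derives Γ (eq (mul one p) p)
  | mul_one (p : Exp α) : Derives Γ (eq (mul p one) p)
  | zero_mul (p : Exp α) : Derives Γ (eq (mul zero p) zero)
  | mul_zero (p : Exp α) : Derives Γ (eq (mul p zero) zero)
  | mul_add (p q r : Exp α) : Derives Γ (eq (mul p (add q r)) (add (mul p q) (mul p r)))
  | add_mul (p q r : Exp α) : Derives Γ (eq (mul (add p q) r) (add (mul p r) (mul q r)))
  -- partial order laws
  | le_refl (p : Exp α) : Derives Γ (le p p)
  | le_antisymm {p q : Exp α} : Derives Γ (le p q) → Derives Γ (le q p) → Derives Γ (eq p q)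
  | le_trans {p q r : Exp α} : Derives Γ (le p q) → Derives Γ (le q r) → Derives Γ (le p r)
  | add_le_add {p q r s : Exp α} : Derives Γ (le p q) → Derives Γ (le r s) →
      Derives Γ (le (add p r) (add q s))
  | mul_le_mul {p q r s : Exp α} : Derives Γ (le p q) → Derives Γ (le r s) →
      Derives Γ (le (mul p r) (mul q s))
  -- star laws
  | star_unfold (p : Exp α) : Derives Γ (le (add one (mul p (star p))) (star p))
  | star_ind_left {p q r : Exp α} : Derives Γ (le (add q (mul p r)) r) →
      Derives Γ (le (mul (star p) q) r)
  | star_ind_right {p q r : Exp α} : Derives Γ (le (add q (mul r p)) r) →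
      Derives Γ (le (mul q (star p)) r)

/-- A Horn formula is a theorem of NKA if its conclusion is derivable from its premises. -/
def HornFormula.IsTheorem {α : Type*} (φ : HornFormula α) : Prop :=
  Derives φ.premises φ.conclusion

/-! ### Quantum superoperators -/

/-- Linear superoperators on the Hilbert space with orthonormal basis indexed by `n`. -/
abbrev SuperOp (n : Type*) [Fintype n] [DecidableEq n] : Type _ :=
  Module.End ℂ (Matrix n n ℂ)

section SuperOp

variable {n : Type*} [Fintype n] [DecidableEq n]

/-- `E ⊗ id` on an ancilla with orthonormal basis indexed by `m`. -/
def SuperOp.tensorId (E : SuperOp n) (m : Type*) (X : Matrix (n × m) (n × m) ℂ) :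
    Matrix (n × m) (n × m) ℂ :=
  Matrix.of fun x y => E (Matrix.of fun i j => X (i, x.2) (j, y.2)) x.1 y.1

/-- The quantum operations on a system: completely positive and trace-non-increasing
superoperators. -/
structure SuperOp.IsQuantumOp (E : SuperOp n) : Prop where
  completelyPositive : ∀ (k : ℕ) (X : Matrix (n × Fin k) (n × Fin k) ℂ),
    X.PosSemidef → (E.tensorId (Fin k) X).PosSemidef
  trace_le : ∀ ρ : Matrix n n ℂ, ρ.PosSemidef → (E ρ).trace.re ≤ ρ.trace.re

/-- The superoperator `ρ ↦ A ρ A†`. -/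
def conj (A : Matrix n n ℂ) : SuperOp n :=
  LinearMap.mulLeft ℂ A ∘ₗ LinearMap.mulRight ℂ Aᴴ

open Classical in
/-- The countable sum `∑ᵢ Eᵢ` of superoperators: the quantum operation `E` with
`E ρ = ∑ᵢ Eᵢ ρ` for all positive semidefinite `ρ`. Positive semidefinite matrices span, so `E` is
unique. The value is `0` if there is no such `E`. -/
noncomputable def superSum (F : ℕ → SuperOp n) : SuperOp n :=
  if h : ∃ E : SuperOp n, E.IsQuantumOp ∧
      ∀ ρ : Matrix n n ℂ, ρ.PosSemidef → HasSum (fun i => F i ρ) (E ρ)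
  then h.choose else 0

end SuperOp

/-! ### Quantum while-programs -/

section Programs

variable {V : Type*} [Fintype V] [DecidableEq V]

/-- Basis labels of the joint space `⨂_{v ∈ S} ℂ^{d v}` of the registers in `S`. -/
abbrev LocalBasis (d : V → ℕ) (S : Finset V) : Type _ := (v : S) → Fin (d v)

/-- Basis labels of the whole space `⨂_v ℂ^{d v}`. -/
abbrev Basis (d : V → ℕ) : Type _ := (v : V) → Fin (d v)

/-- The operator `A ⊗ I` on the whole space, for an operator `A` on the registers in `S`. -/
def cylinder (d : V → ℕ) (S : Finset V) (A : Matrix (LocalBasis d S) (LocalBasis d S) ℂ) :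
    Matrix (Basis d) (Basis d) ℂ :=
  Matrix.of fun x y =>
    if ∀ v, v ∉ S → x v = y v then A (fun v => x v) (fun v => y v) else 0

/-- The operator `|0⟩_q⟨i| ⊗ I` on the whole space. -/
def ketZeroBra (d : V → ℕ) [∀ v, NeZero (d v)] (q : V) (i : Fin (d q)) :
    Matrix (Basis d) (Basis d) ℂ :=
  Matrix.of fun x y => if x q = 0 ∧ y q = i ∧ ∀ v, v ≠ q → x v = y v then 1 else 0

/-- A quantum measurement on the registers in `S` with outcomes `0, …, k - 1`. -/
structure Measurement (d : V → ℕ) (S : Finset V) (k : ℕ) where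
  op : Fin k → Matrix (LocalBasis d S) (LocalBasis d S) ℂ
  complete : ∑ i, (op i)ᴴ * op i = 1

/-- The superoperator `ℳᵢ(ρ) = Mᵢ ρ Mᵢ†` of the outcome `i`. -/
def Measurement.branch {d : V → ℕ} {S : Finset V} {k : ℕ} (M : Measurement d S k) (i : Fin k) :
    SuperOp (Basis d) :=
  conj (cylinder d S (M.op i))

/-- Quantum while-programs over registers `v : V` of dimension `d v`. -/
inductive Program (d : V → ℕ) where
  /-- `skip` -/
  | skip : Program d
  /-- `abort` -/
  | abort : Program d
  /-- `q := |0⟩` -/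
  | reset (q : V) : Program d
  /-- `q̄ := U[q̄]` -/
  | unitary (S : Finset V) (U : Matrix.unitaryGroup (LocalBasis d S) ℂ) : Program d
  /-- `P₁; P₂` -/
  | seq (P₁ P₂ : Program d) : Program d
  /-- `case M[q̄] →ⁱ Pᵢ end` -/
  | case (S : Finset V) (k : ℕ) (M : Measurement d S k) (P : Fin k → Program d) : Program d
  /-- `while M[q̄] = 1 do P done` -/
  | while (S : Finset V) (M : Measurement d S 2) (P : Program d) : Program d

variable {d : V → ℕ} [∀ v, NeZero (d v)]

/-- The superoperator `ρ ↦ ∑ᵢ |0⟩_q⟨i| ρ |i⟩_q⟨0|`. -/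
def resetOp (d : V → ℕ) [∀ v, NeZero (d v)] (q : V) : SuperOp (Basis d) :=
  ∑ i, conj (ketZeroBra d q i)

/-- The superoperator `ρ ↦ U_q̄ ρ U_q̄†`. -/
def unitaryOp (S : Finset V) (U : Matrix.unitaryGroup (LocalBasis d S) ℂ) : SuperOp (Basis d) :=
  conj (cylinder d S U)

/-- Denotational semantics. Multiplication in `SuperOp` is composition of linear maps, so the
map that acts first stands on the right. -/
noncomputable def Program.sem : Program d → SuperOp (Basis d)
  | .skip => 1
  | .abort => 0
  | .reset q => resetOp d q
  | .unitary S U => unitaryOp S U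
  | .seq P₁ P₂ => P₂.sem * P₁.sem
  | .case _ _ M P => ∑ i, (P i).sem * M.branch i
  | .while _ M P => superSum fun n => M.branch 0 * (P.sem * M.branch 1) ^ n

/-- The elementary superoperators (resets, unitaries, measurement branches) of a program. -/
def Program.elementary : Program d → Set (SuperOp (Basis d))
  | .skip => ∅
  | .abort => ∅
  | .reset q => {resetOp d q}
  | .unitary S U => {unitaryOp S U}
  | .seq P₁ P₂ => P₁.elementary ∪ P₂.elementary
  | .case _ _ M P => ⋃ i, insert (M.branch i) (P i).elementary
  | .while _ M P => {M.branch 0, M.branch 1} ∪ P.elementary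

/-- An encoder setting: an assignment of distinct symbols to the members of a finite set of
quantum operations. -/
structure EncoderSetting (d : V → ℕ) (α : Type*) where
  dom : Set (SuperOp (Basis d))
  finite_dom : dom.Finite
  isQuantumOp : ∀ E ∈ dom, SuperOp.IsQuantumOp E
  symbol : dom → α
  symbol_injective : Function.Injective symbol

/-- The encoder setting assigns a symbol to each elementary superoperator of the program. -/
def EncoderSetting.Covers {α : Type*} (E : EncoderSetting d α) (P : Program d) : Prop :=
  P.elementary ⊆ E.dom

/-- The encoding of a program as an expression. -/
def EncoderSetting.enc {α : Type*} (E : EncoderSetting d α) :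
    (P : Program d) → E.Covers P → Exp α
  | .skip, _ => .one
  | .abort, _ => .zero
  | .reset q, h => .sym (E.symbol ⟨resetOp d q, h rfl⟩)
  | .unitary S U, h => .sym (E.symbol ⟨unitaryOp S U, h rfl⟩)
  | .seq P₁ P₂, h =>
      .mul (E.enc P₁ fun _ hx => h (Or.inl hx)) (E.enc P₂ fun _ hx => h (Or.inr hx))
  | .case _ _ M P, h =>
      Exp.sum (List.ofFn fun i =>
        .mul (.sym (E.symbol ⟨M.branch i, h (Set.mem_iUnion.2 ⟨i, Or.inl rfl⟩)⟩))
          (E.enc (P i) fun _ hx => h (Set.mem_iUnion.2 ⟨i, Or.inr hx⟩)))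
  | .while _ M P, h =>
      .mul
        (.star (.mul (.sym (E.symbol ⟨M.branch 1, h (Or.inl (Or.inr rfl))⟩))
          (E.enc P fun _ hx => h (Or.inr hx))))
        (.sym (E.symbol ⟨M.branch 0, h (Or.inl (Or.inl rfl))⟩))

end Programs

end QuantumNKA

namespace QuantumNKA

open scoped ComplexOrder Matrix ENNReal

/-! ### Valuations and their transformers -/

/-! The proof is soundness in a model of NKA that contains the quantum operations faithfully.
Superoperators alone are not a model: a star such as `1*` diverges. Operations therefore act on
functionals with values in `[0, ∞]`, where every sum exists, by `f ↦ f ∘ E`. Monotone,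
sum-preserving maps on these functionals, ordered pointwise and with star the sum of all powers,
satisfy every NKA axiom (`Derives.sound`).

The embedding `act` reverses composition, which matches the order of factors in encodings. It turns
convergent sums of operations into sums of transformers (`act_apply_of_hasSum`), because valuations
preserve convergent sums. It is injective (`act_injective`), because quadratic forms of vectors are
valuations. Hence the encoding of a program is interpreted as the action of its semantics
(`EncoderSetting.interp_enc`). The premises then hold in the model, so the conclusion does, and
injectivity returns it to superoperators. -/

/-- Positive semidefinite matrices. -/
abbrev PSD (n : Type*) [Fintype n] : Type _ := {ρ : Matrix n n ℂ // ρ.PosSemidef}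

/-- `[0, ∞]`-valued functionals on positive semidefinite matrices that preserve convergent sums. -/
@[ext] structure Valuation (n : Type*) [Fintype n] where
  toFun : PSD n → ℝ≥0∞
  map_hasSum : ∀ {ι : Type} (F : ι → PSD n) (ρ : PSD n),
    HasSum (fun i => (F i).1) ρ.1 → toFun ρ = ∑' i, toFun (F i)

namespace Valuation

variable {n : Type*} [Fintype n]

instance : CoeFun (Valuation n) fun _ => PSD n → ℝ≥0∞ := ⟨toFun⟩

/-- The pointwise sum of a family of valuations. -/
noncomputable def sum {ι : Type} (F : ι → Valuation n) : Valuation n where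
  toFun ρ := ∑' i, F i ρ
  map_hasSum G ρ h := by
    rw [ENNReal.tsum_comm]
    exact tsum_congr fun i => (F i).map_hasSum G ρ h

theorem sum_apply {ι : Type} (F : ι → Valuation n) (ρ : PSD n) : sum F ρ = ∑' i, F i ρ := rfl

end Valuation

/-- Monotone maps on valuations that preserve arbitrary sums. -/
@[ext] structure Transformer (n : Type*) [Fintype n] where
  toFun : Valuation n → Valuation n
  mono : ∀ {f g : Valuation n}, (∀ ρ, f ρ ≤ g ρ) → ∀ ρ, toFun f ρ ≤ toFun g ρ
  map_sum : ∀ {ι : Type} (F : ι → Valuation n),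
    toFun (Valuation.sum F) = Valuation.sum fun i => toFun (F i)

namespace Transformer

variable {n : Type*} [Fintype n]

instance : CoeFun (Transformer n) fun _ => Valuation n → Valuation n := ⟨toFun⟩

theorem ext_apply {p q : Transformer n} (h : ∀ f ρ, p f ρ = q f ρ) : p = q :=
  Transformer.ext (funext fun f => Valuation.ext (funext (h f)))

/-- The identity transformer. -/
def one : Transformer n where
  toFun f := f
  mono h := h
  map_sum _ := rfl

/-- Composition of transformers. -/
def mul (p q : Transformer n) : Transformer n where
  toFun f := p (q f)
  mono h := p.mono (q.mono h)
  map_sum F := by rw [q.map_sum, p.map_sum]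

/-- The pointwise sum of a family of transformers. -/
noncomputable def sum {ι : Type} (p : ι → Transformer n) : Transformer n where
  toFun f := Valuation.sum fun i => p i f
  mono h ρ := ENNReal.tsum_le_tsum fun i => (p i).mono h ρ
  map_sum F := by
    ext ρ
    simp only [map_sum, Valuation.sum_apply]
    exact ENNReal.tsum_comm

/-- The zero transformer. -/
noncomputable def zero : Transformer n := sum (Empty.elim : Empty → Transformer n)

/-- The sum of two transformers. -/
noncomputable def add (p q : Transformer n) : Transformer n := sum fun b : Bool => cond b p q

/-- Iterated composition. -/
def pow (p : Transformer n) : ℕ → Transformer n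
  | 0 => one
  | k + 1 => mul p (pow p k)

/-- The sum of all powers of a transformer. -/
noncomputable def star (p : Transformer n) : Transformer n := sum p.pow

theorem one_apply (f : Valuation n) : (one : Transformer n) f = f := rfl

theorem mul_apply (p q : Transformer n) (f : Valuation n) : mul p q f = p (q f) := rfl

theorem sum_apply {ι : Type} (p : ι → Transformer n) (f : Valuation n) :
    sum p f = Valuation.sum fun i => p i f := rfl

theorem zero_apply (f : Valuation n) (ρ : PSD n) : (zero : Transformer n) f ρ = 0 := by
  simp [zero, sum_apply, Valuation.sum_apply]

theorem add_apply (p q : Transformer n) (f : Valuation n) (ρ : PSD n) :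
    add p q f ρ = p f ρ + q f ρ := by
  simp [add, sum_apply, Valuation.sum_apply]

theorem star_apply (p : Transformer n) (f : Valuation n) (ρ : PSD n) :
    star p f ρ = ∑' k, p.pow k f ρ := rfl

theorem apply_sum {ι : Type} (p : Transformer n) (F : ι → Valuation n) (ρ : PSD n) :
    p (Valuation.sum F) ρ = ∑' i, p (F i) ρ := by
  rw [p.map_sum]; rfl

theorem mul_zero (p : Transformer n) : mul p zero = zero := by
  refine ext_apply fun f ρ => ?_
  rw [mul_apply, zero_apply, zero, sum_apply, apply_sum, tsum_empty]

theorem apply_add (p q r : Transformer n) (f : Valuation n) (ρ : PSD n) :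
    p (add q r f) ρ = p (q f) ρ + p (r f) ρ := by
  rw [add, sum_apply, apply_sum, tsum_bool, add_comm]
  rfl

/-- The pointwise order on transformers. -/
def Le (p q : Transformer n) : Prop := ∀ f ρ, p f ρ ≤ q f ρ

/-- Preservation of infinite sums moves `p` inside the series, which then lacks only its zeroth
term. -/
theorem one_add_mul_star (p : Transformer n) : add one (mul p (star p)) = star p := by
  refine ext_apply fun f ρ => ?_
  rw [add_apply, star_apply p f, mul_apply, star, sum_apply, apply_sum,
    tsum_eq_zero_add' (f := fun k => p.pow k f ρ) ENNReal.summable]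
  rfl

theorem star_mul_le {p q r : Transformer n} (h : Le (add q (mul p r)) r) :
    Le (mul (star p) q) r := by
  intro f ρ
  rw [mul_apply, star_apply]
  -- The partial sums are packaged as valuations so that monotonicity of `p` applies to the
  -- induction hypothesis: the next partial sum is `q + p · (previous one) ≤ q + p r ≤ r`.
  have key : ∀ (N : ℕ) ρ, Valuation.sum (fun k : Fin N => p.pow k (q f)) ρ ≤ r f ρ := by
    intro N
    induction N with
    | zero => intro ρ; simp [Valuation.sum_apply]
    | succ N ih =>
      intro ρ
      refine le_trans ?_ (h f ρ)
      rw [add_apply, mul_apply]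
      refine le_trans (le_of_eq ?_) (add_le_add_right (p.mono ih ρ) _)
      rw [apply_sum, Valuation.sum_apply, tsum_fintype, tsum_fintype, Fin.sum_univ_succ]
      rfl
  refine ENNReal.tsum_le_of_sum_range_le fun N => le_trans (le_of_eq ?_) (key N ρ)
  rw [Valuation.sum_apply, tsum_fintype, Finset.sum_range]

theorem mul_star_le {p q r : Transformer n} (h : Le (add q (mul r p)) r) :
    Le (mul q (star p)) r := by
  intro f ρ
  rw [mul_apply, star, sum_apply, apply_sum]
  -- Here the inequality `q + r p ≤ r` is evaluated at `p ^ N f`, so the remainder `r p ^ N` has to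
  -- be carried along; it is discarded at the end.
  have key : ∀ N : ℕ,
      ∑ k ∈ Finset.range N, q (p.pow k f) ρ + r (p.pow N f) ρ ≤ r f ρ := by
    intro N
    induction N with
    | zero => simp [pow, one_apply]
    | succ N ih =>
      refine le_trans ?_ ih
      rw [Finset.sum_range_succ, add_assoc]
      refine add_le_add_right (le_trans (le_of_eq ?_) (h (p.pow N f) ρ)) _
      rw [add_apply]
      rfl
  exact ENNReal.tsum_le_of_sum_range_le fun N => le_trans le_self_add (key N)

end Transformer

/-! ### Soundness of NKA in the algebra of transformers -/

section Interpretation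

variable {n : Type*} [Fintype n] {α : Type*}

/-- The interpretation of an expression, given that of the letters. -/
noncomputable def Exp.interp (v : α → Transformer n) : Exp α → Transformer n
  | .zero => .zero
  | .one => .one
  | .sym a => v a
  | .add e f => .add (e.interp v) (f.interp v)
  | .mul e f => .mul (e.interp v) (f.interp v)
  | .star e => .star (e.interp v)

/-- Validity of an atomic formula under an interpretation of the letters. -/
def Formula.Holds (v : α → Transformer n) : Formula α → Prop
  | .eq e f => e.interp v = f.interp v
  | .le e f => (e.interp v).Le (f.interp v)

theorem Exp.interp_sum (v : α → Transformer n) (l : List (Exp α)) (f : Valuation n) (ρ : PSD n) :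
    (Exp.sum l).interp v f ρ = (l.map fun e => e.interp v f ρ).sum := by
  induction l with
  | nil => exact Transformer.zero_apply f ρ
  | cons e l ih =>
    cases l with
    | nil => simp [Exp.sum]
    | cons e' l =>
      rw [Exp.sum, Exp.interp, Transformer.add_apply, ih]
      rfl

open Transformer in
theorem Derives.sound {Γ : List (Formula α)} {φ : Formula α} (h : Derives Γ φ)
    (v : α → Transformer n) (hΓ : ∀ ψ ∈ Γ, ψ.Holds v) : φ.Holds v := by
  induction h with
  | hyp h => exact hΓ _ h
  | eq_refl p => exact rfl
  | eq_symm _ ih => exact Eq.symm ih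
  | eq_trans _ _ ih₁ ih₂ => exact Eq.trans ih₁ ih₂
  | add_congr _ _ ih₁ ih₂ => exact congrArg₂ Transformer.add ih₁ ih₂
  | mul_congr _ _ ih₁ ih₂ => exact congrArg₂ Transformer.mul ih₁ ih₂
  | star_congr _ ih => exact congrArg Transformer.star ih
  | le_congr _ _ _ ih₁ ih₂ ih₃ =>
    simp only [Formula.Holds] at ih₁ ih₂ ih₃ ⊢
    rwa [← ih₁, ← ih₂]
  | add_assoc p q r =>
    exact ext_apply fun f ρ => by simp [Exp.interp, Transformer.add_apply, _root_.add_assoc]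
  | add_comm p q =>
    exact ext_apply fun f ρ => by simp [Exp.interp, Transformer.add_apply, _root_.add_comm]
  | add_zero p => exact ext_apply fun f ρ => by simp [Exp.interp, Transformer.add_apply, Transformer.zero_apply]
  | mul_assoc p q r => exact rfl
  | one_mul p => exact rfl
  | mul_one p => exact rfl
  | zero_mul p => exact ext_apply fun f ρ => by simp [Exp.interp, Transformer.mul_apply, Transformer.zero_apply]
  | mul_zero p => exact Transformer.mul_zero _
  | mul_add p q r =>
    exact ext_apply fun f ρ => by
      simp [Exp.interp, Transformer.mul_apply, apply_add, Transformer.add_apply]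
  | add_mul p q r => exact ext_apply fun f ρ => by simp [Exp.interp, Transformer.mul_apply, Transformer.add_apply]
  | le_refl p => exact fun f ρ => le_rfl
  | le_antisymm _ _ ih₁ ih₂ => exact ext_apply fun f ρ => _root_.le_antisymm (ih₁ f ρ) (ih₂ f ρ)
  | le_trans _ _ ih₁ ih₂ => exact fun f ρ => _root_.le_trans (ih₁ f ρ) (ih₂ f ρ)
  | add_le_add _ _ ih₁ ih₂ =>
    intro f ρ
    simp only [Exp.interp, Transformer.add_apply]
    exact _root_.add_le_add (ih₁ f ρ) (ih₂ f ρ)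
  | mul_le_mul _ _ ih₁ ih₂ =>
    exact fun f ρ => _root_.le_trans (Transformer.mono _ (ih₂ f) ρ) (ih₁ _ ρ)
  | star_unfold p =>
    have h := one_add_mul_star (p.interp v)
    exact fun f ρ => le_of_eq (congrArg (fun t : Transformer n => t f ρ) h)
  | star_ind_left _ ih => exact star_mul_le ih
  | star_ind_right _ ih => exact mul_star_le ih

end Interpretation

/-! ### Quantum operations -/

section QuantumOp

variable {n : Type*} [Fintype n] [DecidableEq n]

/-- With the L2 operator norm the matrices form a C⋆-algebra, and nonnegative elements span any such
algebra. -/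
theorem span_posSemidef : Submodule.span ℂ {ρ : Matrix n n ℂ | ρ.PosSemidef} = ⊤ := by
  open scoped MatrixOrder Matrix.Norms.L2Operator in
  have h := CStarAlgebra.span_nonneg (A := Matrix n n ℂ)
  simpa only [Matrix.nonneg_iff_posSemidef] using h

theorem SuperOp.ext_posSemidef {E F : SuperOp n}
    (h : ∀ ρ : Matrix n n ℂ, ρ.PosSemidef → E ρ = F ρ) :
    E = F :=
  LinearMap.ext_on span_posSemidef h

/-- Write `ρ = Bᴴ B` and bound each `‖B k i‖ ‖B k j‖` by the mean of the two squares. Bounded traces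
thus yield entrywise absolute convergence. -/
theorem norm_apply_le_trace {ρ : Matrix n n ℂ} (h : ρ.PosSemidef) (i j : n) :
    ‖ρ i j‖ ≤ ρ.trace.re := by
  obtain ⟨B, rfl⟩ : ∃ B : Matrix n n ℂ, ρ = Bᴴ * B := by
    open scoped MatrixOrder in
    exact CStarAlgebra.nonneg_iff_eq_star_mul_self.1 (Matrix.nonneg_iff_posSemidef.2 h)
  have htr : (Bᴴ * B).trace.re = ∑ k, ∑ l, ‖B k l‖ ^ 2 := by
    rw [Finset.sum_comm]
    simp only [Matrix.trace, Matrix.diag_apply, Matrix.mul_apply, Matrix.conjTranspose_apply,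
      Complex.re_sum]
    refine Finset.sum_congr rfl fun l _ => Finset.sum_congr rfl fun k _ => ?_
    rw [← Complex.normSq_eq_norm_sq, Complex.star_def, ← Complex.normSq_eq_conj_mul_self,
      Complex.ofReal_re]
  rw [htr, Matrix.mul_apply]
  refine (norm_sum_le _ _).trans (Finset.sum_le_sum fun k _ => ?_)
  have hle : ∀ l, ‖B k l‖ ^ 2 ≤ ∑ l, ‖B k l‖ ^ 2 := fun l =>
    Finset.single_le_sum (f := fun l => ‖B k l‖ ^ 2) (fun _ _ => by positivity) (Finset.mem_univ l)
  rw [norm_mul, Matrix.conjTranspose_apply, norm_star]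
  nlinarith [hle i, hle j, sq_nonneg (‖B k i‖ - ‖B k j‖)]

theorem trace_re_nonneg {m : Type*} [Fintype m] {ρ : Matrix m m ℂ} (h : ρ.PosSemidef) : 0 ≤ ρ.trace.re :=
  (Complex.le_def.1 h.trace_nonneg).1

/-! ### Closure properties of completely positive maps and quantum operations -/

namespace SuperOp

/-- Complete positivity. -/
def IsCP (E : SuperOp n) : Prop :=
  ∀ (k : ℕ) (X : Matrix (n × Fin k) (n × Fin k) ℂ),
    X.PosSemidef → (E.tensorId (Fin k) X).PosSemidef

theorem IsCP.posSemidef {E : SuperOp n} (hE : E.IsCP) {ρ : Matrix n n ℂ} (hρ : ρ.PosSemidef) :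
    (E ρ).PosSemidef :=
  -- Positivity is complete positivity with a one-dimensional ancilla.
  (hE 1 _ (hρ.submatrix (Prod.fst : n × Fin 1 → n))).submatrix fun i => (i, 0)

theorem isCP_one : (1 : SuperOp n).IsCP := fun _ _ h => h

theorem isCP_zero : (0 : SuperOp n).IsCP := fun _ _ _ => Matrix.PosSemidef.zero

theorem IsCP.mul {E F : SuperOp n} (hE : E.IsCP) (hF : F.IsCP) : (E * F).IsCP :=
  fun k X hX => hE k _ (hF k X hX)

theorem IsCP.pow {E : SuperOp n} (hE : E.IsCP) (k : ℕ) : (E ^ k).IsCP := by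
  induction k with
  | zero => exact isCP_one
  | succ k ih => rw [pow_succ]; exact ih.mul hE

theorem IsCP.sum {ι : Type*} (s : Finset ι) {E : ι → SuperOp n} (hE : ∀ i, (E i).IsCP) :
    (∑ i ∈ s, E i).IsCP := by
  classical
  induction s using Finset.induction_on with
  | empty => exact isCP_zero
  | insert i s hi ih =>
    rw [Finset.sum_insert hi]
    exact fun k X hX => (hE i k X hX).add (ih k X hX)

theorem isQuantumOp_one : (1 : SuperOp n).IsQuantumOp := ⟨isCP_one, fun _ _ => le_rfl⟩

theorem isQuantumOp_zero : (0 : SuperOp n).IsQuantumOp :=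
  ⟨isCP_zero, fun _ h => by simpa using trace_re_nonneg h⟩

theorem IsQuantumOp.isCP {E : SuperOp n} (hE : E.IsQuantumOp) : E.IsCP := hE.completelyPositive

theorem IsQuantumOp.mul {E F : SuperOp n} (hE : E.IsQuantumOp) (hF : F.IsQuantumOp) :
    (E * F).IsQuantumOp :=
  ⟨hE.isCP.mul hF.isCP, fun ρ hρ =>
    (hE.trace_le _ (hF.isCP.posSemidef hρ)).trans (hF.trace_le ρ hρ)⟩

theorem continuous (E : SuperOp n) : Continuous E := E.continuous_of_finiteDimensional

end SuperOp

theorem isClosed_posSemidef {m : Type*} [Fintype m] :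
    IsClosed {X : Matrix m m ℂ | X.PosSemidef} := by
  simp only [Matrix.posSemidef_iff_dotProduct_mulVec, Set.ofPred_and, Set.ofPred_forall]
  refine IsClosed.inter ?_ (isClosed_iInter fun x => ?_)
  · exact isClosed_eq (by fun_prop) continuous_id
  · exact isClosed_le continuous_const (by fun_prop)

/-- Completely positive superoperators whose partial sums do not increase the trace have a sum. -/
theorem exists_isQuantumOp_hasSum {F : ℕ → SuperOp n} (hF : ∀ i, (F i).IsCP)
    (htr : ∀ ρ : Matrix n n ℂ, ρ.PosSemidef →
      ∀ N, ∑ i ∈ Finset.range N, (F i ρ).trace.re ≤ ρ.trace.re) :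
    ∃ E : SuperOp n, E.IsQuantumOp ∧
      ∀ ρ : Matrix n n ℂ, ρ.PosSemidef → HasSum (fun i => F i ρ) (E ρ) := by
  have hpos : ∀ ρ : Matrix n n ℂ, ρ.PosSemidef → Summable fun i => F i ρ := fun ρ hρ => by
    refine Pi.summable.2 fun a => Pi.summable.2 fun b => ?_
    refine Summable.of_norm_bounded (g := fun i => (F i ρ).trace.re) ?_
      fun i => norm_apply_le_trace ((hF i).posSemidef hρ) a b
    exact summable_of_sum_range_le (fun i => trace_re_nonneg ((hF i).posSemidef hρ)) (htr ρ hρ)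
  -- Summability extends linearly from positive semidefinite matrices to their span, so the sum is a
  -- superoperator.
  have hsum : ∀ X : Matrix n n ℂ, Summable fun i => F i X := fun X => by
    have hX : X ∈ Submodule.span ℂ {ρ : Matrix n n ℂ | ρ.PosSemidef} := by
      rw [span_posSemidef]; trivial
    induction hX using Submodule.span_induction with
    | mem ρ hρ => exact hpos ρ hρ
    | zero => simp
    | add X Y _ _ hX hY => simpa using hX.add hY
    | smul c X _ hX => simpa using hX.const_smul c
  let E : SuperOp n :=
    { toFun := fun X => ∑' i, F i X
      map_add' := fun X Y => by simp only [map_add]; exact (hsum X).tsum_add (hsum Y)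
      map_smul' := fun c X => by simp only [map_smul]; exact (hsum X).tsum_const_smul c }
  have hE : ∀ X, HasSum (fun i => F i X) (E X) := fun X => (hsum X).hasSum
  refine ⟨E, ⟨fun k X hX => ?_, fun ρ hρ => ?_⟩, fun ρ _ => hE ρ⟩
  · have h : HasSum (fun i => (F i).tensorId (Fin k) X) (E.tensorId (Fin k) X) :=
      Pi.hasSum.2 fun x => Pi.hasSum.2 fun y => Pi.hasSum.1 (Pi.hasSum.1 (hE _) x.1) y.1
    refine isClosed_posSemidef.mem_of_tendsto h (.of_forall fun s => ?_)
    exact Matrix.posSemidef_sum s fun i _ => hF i k X hX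
  · have h : HasSum (fun i => (F i ρ).trace.re) (E ρ).trace.re :=
      (hE ρ).map (Complex.reAddGroupHom.comp (Matrix.traceAddMonoidHom n ℂ))
        (Complex.continuous_re.comp continuous_id.matrix_trace)
    exact le_of_tendsto h.tendsto_sum_nat (.of_forall (htr ρ hρ))

theorem superSum_spec {F : ℕ → SuperOp n}
    (h : ∃ E : SuperOp n, E.IsQuantumOp ∧
      ∀ ρ : Matrix n n ℂ, ρ.PosSemidef → HasSum (fun i => F i ρ) (E ρ)) :
    (superSum F).IsQuantumOp ∧
      ∀ ρ : Matrix n n ℂ, ρ.PosSemidef → HasSum (fun i => F i ρ) (superSum F ρ) := by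
  rw [superSum, dif_pos h]
  exact h.choose_spec

/-! ### The action of quantum operations on valuations -/

/-- Completely positive superoperators act on valuations by precomposition. -/
def act (E : SuperOp n) (hE : E.IsCP) : Transformer n where
  toFun f :=
    { toFun := fun ρ => f ⟨E ρ, hE.posSemidef ρ.2⟩
      map_hasSum := fun G _ h => f.map_hasSum (fun i => ⟨E (G i), hE.posSemidef (G i).2⟩) _
        (h.map E E.continuous) }
  mono h _ := h _
  map_sum _ := rfl

theorem act_apply (E : SuperOp n) (hE : E.IsCP) (f : Valuation n) (ρ : PSD n) :
    act E hE f ρ = f ⟨E ρ, hE.posSemidef ρ.2⟩ := rfl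

/-- Serves both the finite sums of `case` and the infinite sums of `while`. -/
theorem act_apply_of_hasSum {ι : Type} {E : SuperOp n} (hE : E.IsCP) {F : ι → SuperOp n}
    (hF : ∀ i, (F i).IsCP)
    (h : ∀ ρ : Matrix n n ℂ, ρ.PosSemidef → HasSum (fun i => F i ρ) (E ρ))
    (f : Valuation n) (ρ : PSD n) : act E hE f ρ = ∑' i, act (F i) (hF i) f ρ :=
  f.map_hasSum (fun i => ⟨F i ρ, (hF i).posSemidef ρ.2⟩) _ (h ρ ρ.2)

theorem act_pow {E : SuperOp n} (hE : E.IsCP) (k : ℕ) :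
    (act E hE).pow k = act (E ^ k) (hE.pow k) := by
  induction k with
  | zero => rfl
  | succ k ih =>
    rw [Transformer.pow, ih]
    refine Transformer.ext_apply fun f ρ => ?_
    simp only [Transformer.mul_apply, act_apply, pow_succ]
    rfl

/-- The quadratic form of a vector, as a valuation. -/
noncomputable def Valuation.ofVector (x : n → ℂ) : Valuation n where
  toFun ρ := ENNReal.ofReal (star x ⬝ᵥ (ρ.1 *ᵥ x)).re
  map_hasSum F ρ h := by
    have h' : HasSum (fun i => (star x ⬝ᵥ ((F i).1 *ᵥ x)).re) (star x ⬝ᵥ (ρ.1 *ᵥ x)).re := by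
      let φ : Matrix n n ℂ →+ ℝ :=
        { toFun := fun X => (star x ⬝ᵥ (X *ᵥ x)).re
          map_zero' := by simp
          map_add' := fun X Y => by simp [Matrix.add_mulVec, dotProduct_add] }
      exact h.map φ (show Continuous fun X : Matrix n n ℂ => (star x ⬝ᵥ (X *ᵥ x)).re by fun_prop)
    rw [← h'.tsum_eq]
    exact ENNReal.ofReal_tsum_of_nonneg (fun i => (F i).2.re_dotProduct_nonneg x) h'.summable

/-- Evaluating at `Valuation.ofVector x` recovers the quadratic forms of `E ρ` and `F ρ`. These
determine the matrices, and positive semidefinite `ρ` span. -/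
theorem act_injective {E F : SuperOp n} {hE : E.IsCP} {hF : F.IsCP} (h : act E hE = act F hF) :
    E = F := by
  refine SuperOp.ext_posSemidef fun ρ hρ => ?_
  have hq : ∀ x : n → ℂ, star x ⬝ᵥ (E ρ *ᵥ x) = star x ⬝ᵥ (F ρ *ᵥ x) := fun x => by
    have hEρ := (hE.posSemidef hρ).dotProduct_mulVec_nonneg x
    have hFρ := (hF.posSemidef hρ).dotProduct_mulVec_nonneg x
    have h1 := congrArg (fun p : Transformer n => p (.ofVector x) ⟨ρ, hρ⟩) h
    have h2 := (ENNReal.ofReal_eq_ofReal_iff (Complex.le_def.1 hEρ).1 (Complex.le_def.1 hFρ).1).1 h1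
    exact Complex.ext h2 ((Complex.le_def.1 hEρ).2.symm.trans (Complex.le_def.1 hFρ).2)
  open scoped MatrixOrder in
  -- Both differences have vanishing quadratic form, so they are positive semidefinite and the
  -- Loewner order is antisymmetric.
  refine le_antisymm (Matrix.le_iff.2 ?_) (Matrix.le_iff.2 ?_) <;>
  · refine Matrix.PosSemidef.of_dotProduct_mulVec_nonneg ?_ fun x => ?_
    · first
      | exact (hF.posSemidef hρ).1.sub (hE.posSemidef hρ).1
      | exact (hE.posSemidef hρ).1.sub (hF.posSemidef hρ).1
    · rw [Matrix.sub_mulVec, dotProduct_sub, hq x, sub_self]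

end QuantumOp

/-! ### Measurements on some of the registers -/

section Programs

variable {V : Type*} [Fintype V] [DecidableEq V] {d : V → ℕ}

theorem cylinder_one (S : Finset V) : cylinder d S 1 = 1 := by
  ext x y
  simp only [cylinder, Matrix.of_apply, Matrix.one_apply]
  by_cases h : x = y
  · simp [h]
  · rw [if_neg h]
    split_ifs with h₁ h₂
    · refine absurd (funext fun v => ?_) h
      by_cases hv : v ∈ S
      · exact congrFun h₂ ⟨v, hv⟩
      · exact h₁ v hv
    · rfl
    · rfl

theorem cylinder_conjTranspose (S : Finset V) (A : Matrix (LocalBasis d S) (LocalBasis d S) ℂ) :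
    (cylinder d S A)ᴴ = cylinder d S Aᴴ := by
  ext x y
  simp only [cylinder, Matrix.of_apply, Matrix.conjTranspose_apply, eq_comm (a := x _),
    apply_ite star, star_zero]

theorem cylinder_mul (S : Finset V) (A B : Matrix (LocalBasis d S) (LocalBasis d S) ℂ) :
    cylinder d S A * cylinder d S B = cylinder d S (A * B) := by
  ext x z
  simp only [cylinder, Matrix.mul_apply, Matrix.of_apply]
  -- Once `x` and `y` agree off `S`, the second condition no longer involves `y` and leaves the sum.
  have hstep : ∀ y : Basis d,
      ((if ∀ v, v ∉ S → x v = y v then A (fun v => x v) (fun v => y v) else 0) *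
        if ∀ v, v ∉ S → y v = z v then B (fun v => y v) (fun v => z v) else 0) =
      if ∀ v, v ∉ S → x v = y v then
        (if ∀ v, v ∉ S → x v = z v then
          A (fun v => x v) (fun v => y v) * B (fun v => y v) (fun v => z v) else 0) else 0 := fun y => by
    by_cases h : ∀ v, v ∉ S → x v = y v
    · have : (∀ v, v ∉ S → y v = z v) ↔ ∀ v, v ∉ S → x v = z v :=
        forall₂_congr fun v hv => by rw [h v hv]
      simp only [if_pos h, this, mul_ite, mul_zero]
    · simp only [if_neg h, zero_mul]
  rw [Finset.sum_congr rfl fun y _ => hstep y, ← Finset.sum_filter]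
  by_cases hxz : ∀ v, v ∉ S → x v = z v
  · simp only [if_pos hxz]
    -- Labels agreeing with `x` off `S` correspond to local labels on `S`, extended by `x`.
    refine Finset.sum_bij' (fun y _ => fun v : S => y v)
      (fun y _ => fun v => if hv : v ∈ S then y ⟨v, hv⟩ else x v) ?_ ?_ ?_ ?_ ?_
    · simp
    · intro y _
      simp only [Finset.mem_filter, Finset.mem_univ, true_and]
      intro v hv
      rw [dif_neg hv]
    · intro y hy
      simp only [Finset.mem_filter, Finset.mem_univ, true_and] at hy
      funext v
      by_cases hv : v ∈ S
      · simp only [dif_pos hv]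
      · simp only [dif_neg hv, hy v hv]
    · intro y _
      funext v
      simp only [dif_pos v.2]
    · intros; rfl
  · simp only [if_neg hxz, Finset.sum_const_zero]

theorem cylinder_sum (S : Finset V) {ι : Type*} (s : Finset ι)
    (A : ι → Matrix (LocalBasis d S) (LocalBasis d S) ℂ) :
    cylinder d S (∑ i ∈ s, A i) = ∑ i ∈ s, cylinder d S (A i) := by
  ext x y
  simp only [cylinder, Matrix.of_apply, Matrix.sum_apply]
  split_ifs <;> simp

/-- Cyclicity gives `tr (M ρ M†) = tr (ρ M† M)`, and `cylinder` carries the completeness relation to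
the whole space. -/
theorem Measurement.sum_trace_branch {S : Finset V} {k : ℕ} (M : Measurement d S k)
    (ρ : Matrix (Basis d) (Basis d) ℂ) : ∑ i, (M.branch i ρ).trace = ρ.trace := by
  have hbranch : ∀ i, (M.branch i ρ).trace = (ρ * cylinder d S ((M.op i)ᴴ * M.op i)).trace := by
    intro i
    rw [← cylinder_mul, ← cylinder_conjTranspose, ← mul_assoc, Matrix.trace_mul_comm]
    rfl
  rw [Finset.sum_congr rfl fun i _ => hbranch i, ← Matrix.trace_sum, ← Finset.mul_sum,
    ← cylinder_sum, M.complete, cylinder_one, mul_one]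

theorem Measurement.sum_trace_branch_re {S : Finset V} {k : ℕ} (M : Measurement d S k)
    (ρ : Matrix (Basis d) (Basis d) ℂ) : ∑ i, (M.branch i ρ).trace.re = ρ.trace.re := by
  rw [← M.sum_trace_branch ρ, Complex.re_sum]

theorem isQuantumOp_case {S : Finset V} {k : ℕ} (M : Measurement d S k)
    (hM : ∀ i, (M.branch i).IsQuantumOp) {F : Fin k → SuperOp (Basis d)}
    (hF : ∀ i, (F i).IsQuantumOp) : (∑ i, F i * M.branch i).IsQuantumOp := by
  refine ⟨SuperOp.IsCP.sum _ fun i => (hF i).isCP.mul (hM i).isCP, fun ρ hρ => ?_⟩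
  rw [← M.sum_trace_branch_re ρ, LinearMap.sum_apply, Matrix.trace_sum, Complex.re_sum]
  exact Finset.sum_le_sum fun i _ => (hF i).trace_le _ ((hM i).isCP.posSemidef hρ)

theorem superSum_while_spec {S : Finset V} (M : Measurement d S 2)
    (hM : ∀ i, (M.branch i).IsQuantumOp) {F : SuperOp (Basis d)} (hF : F.IsQuantumOp) :
    (superSum fun n => M.branch 0 * (F * M.branch 1) ^ n).IsQuantumOp ∧
      ∀ ρ : Matrix (Basis d) (Basis d) ℂ, ρ.PosSemidef →
        HasSum (fun n => (M.branch 0 * (F * M.branch 1) ^ n) ρ)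
          ((superSum fun n => M.branch 0 * (F * M.branch 1) ^ n) ρ) := by
  have hB := hF.isCP.mul (hM 1).isCP
  refine superSum_spec (exists_isQuantumOp_hasSum (fun n => (hM 0).isCP.mul (hB.pow n))
    fun ρ hρ N => ?_)
  -- The trace that has left the loop plus the trace still inside never exceeds the initial trace.
  have key : ∑ n ∈ Finset.range N, ((M.branch 0 * (F * M.branch 1) ^ n) ρ).trace.re +
      (((F * M.branch 1) ^ N) ρ).trace.re ≤ ρ.trace.re := by
    induction N with
    | zero => simp
    | succ N ih =>
      refine le_trans ?_ ih
      have hσ := (hB.pow N).posSemidef hρ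
      have h1 := M.sum_trace_branch_re (((F * M.branch 1) ^ N) ρ)
      have h2 := hF.trace_le _ ((hM 1).isCP.posSemidef hσ)
      rw [Fin.sum_univ_two] at h1
      rw [Finset.sum_range_succ, pow_succ']
      simp only [Module.End.mul_apply] at h1 h2 ⊢
      linarith
  have := trace_re_nonneg ((hB.pow N).posSemidef hρ)
  linarith

/-! ### Encodings -/

variable {α : Type*}

open Classical in
/-- The interpretation of letters that decodes an encoder setting. -/
noncomputable def EncoderSetting.decode (E : EncoderSetting d α) (a : α) :
    Transformer (Basis d) :=
  -- Letters outside the range of `E.symbol` occur in no encoding, so their value is immaterial.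
  if h : ∃ e, E.symbol e = a then act h.choose.1 (E.isQuantumOp _ h.choose.2).isCP else .zero

theorem EncoderSetting.decode_symbol (E : EncoderSetting d α) (e : E.dom) :
    E.decode (E.symbol e) = act e.1 (E.isQuantumOp _ e.2).isCP := by
  have h : ∃ e', E.symbol e' = E.symbol e := ⟨e, rfl⟩
  have he : h.choose = e := E.symbol_injective h.choose_spec
  rw [decode, dif_pos h]
  simp only [he]

/-- `act` needs complete positivity, so the semantics is shown to be a quantum operation in the same
induction. For elementary superoperators this comes from membership in `E.dom`. -/
theorem EncoderSetting.interp_enc [∀ v, NeZero (d v)] (E : EncoderSetting d α) (P : Program d)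
    (hP : E.Covers P) :
    ∃ h : P.sem.IsQuantumOp, (E.enc P hP).interp E.decode = act P.sem h.isCP := by
  induction P with
  | skip => exact ⟨SuperOp.isQuantumOp_one, rfl⟩
  | abort =>
    refine ⟨SuperOp.isQuantumOp_zero, Transformer.ext_apply fun f ρ => ?_⟩
    -- The zero matrix is an empty sum, so every valuation vanishes there.
    have h := f.map_hasSum (Empty.elim : Empty → _) ⟨0, .zero⟩ hasSum_empty
    exact (Transformer.zero_apply f ρ).trans (h.trans tsum_empty).symm
  | reset q => exact ⟨E.isQuantumOp _ (hP rfl), E.decode_symbol _⟩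
  | unitary S U => exact ⟨E.isQuantumOp _ (hP rfl), E.decode_symbol _⟩
  | seq P₁ P₂ ih₁ ih₂ =>
    obtain ⟨h₁, e₁⟩ := ih₁ fun _ hx => hP (Or.inl hx)
    obtain ⟨h₂, e₂⟩ := ih₂ fun _ hx => hP (Or.inr hx)
    refine ⟨h₂.mul h₁, ?_⟩
    rw [enc, Exp.interp, e₁, e₂]
    rfl
  | case S k M P ih =>
    have hM : ∀ i, M.branch i ∈ E.dom := fun i => hP (Set.mem_iUnion.2 ⟨i, Or.inl rfl⟩)
    choose h e using fun i => ih i fun _ hx => hP (Set.mem_iUnion.2 ⟨i, Or.inr hx⟩)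
    refine ⟨isQuantumOp_case M (fun i => E.isQuantumOp _ (hM i)) h,
      Transformer.ext_apply fun f ρ => ?_⟩
    rw [enc, Exp.interp_sum, List.map_ofFn, List.sum_ofFn]
    refine Eq.trans ?_ (act_apply_of_hasSum _
      (fun i => (h i).isCP.mul (E.isQuantumOp _ (hM i)).isCP) (fun ρ _ => ?_) f ρ).symm
    · rw [tsum_fintype]
      refine Finset.sum_congr rfl fun i _ => ?_
      simp only [Function.comp_apply, Exp.interp, E.decode_symbol, e]
      rfl
    · rw [Program.sem, LinearMap.sum_apply]
      exact hasSum_fintype _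
  | _ S M P ih =>
    have h0 : M.branch 0 ∈ E.dom := hP (Or.inl (Or.inl rfl))
    have h1 : M.branch 1 ∈ E.dom := hP (Or.inl (Or.inr rfl))
    obtain ⟨h, e⟩ := ih fun _ hx => hP (Or.inr hx)
    have hM : ∀ i, (M.branch i).IsQuantumOp :=
      Fin.forall_fin_two.2 ⟨E.isQuantumOp _ h0, E.isQuantumOp _ h1⟩
    have hB := h.isCP.mul (hM 1).isCP
    have hspec := superSum_while_spec M hM h
    refine ⟨hspec.1, Transformer.ext_apply fun f ρ => ?_⟩
    refine Eq.trans ?_ (act_apply_of_hasSum _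
      (fun n => (hM 0).isCP.mul (hB.pow n)) hspec.2 f ρ).symm
    -- Definitional, since precomposition reverses the order of composition.
    have hbody : Transformer.mul (act (M.branch 1) (hM 1).isCP) (act P.sem h.isCP) =
        act (P.sem * M.branch 1) hB := rfl
    simp only [enc, Exp.interp, E.decode_symbol, e, hbody, Transformer.mul_apply,
      Transformer.star_apply, act_pow]
    rfl

end Programs

end QuantumNKA

open QuantumNKA in
theorem theorem1 {V : Type*} [Fintype V] [DecidableEq V] (d : V → ℕ) [∀ v, NeZero (d v)]
    {α : Type*} (E : EncoderSetting d α)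
    (P Q : Program d) (hP : E.Covers P) (hQ : E.Covers Q)
    (k : ℕ) (P' Q' : Fin k → Program d)
    (hP' : ∀ i, E.Covers (P' i)) (hQ' : ∀ i, E.Covers (Q' i))
    (hsem : ∀ i, (P' i).sem = (Q' i).sem)
    (hder : HornFormula.IsTheorem
      { premises := List.ofFn fun i => Formula.eq (E.enc (P' i) (hP' i)) (E.enc (Q' i) (hQ' i))
        conclusion := Formula.eq (E.enc P hP) (E.enc Q hQ) }) :
    P.sem = Q.sem := by
  obtain ⟨hp, eP⟩ := E.interp_enc P hP
  obtain ⟨hq, eQ⟩ := E.interp_enc Q hQ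
  refine act_injective (eP.symm.trans (Eq.trans ?_ eQ))
  refine Derives.sound hder E.decode fun ψ hψ => ?_
  obtain ⟨i, rfl⟩ := (List.mem_ofFn' _ _).1 hψ
  obtain ⟨h₁, e₁⟩ := E.interp_enc (P' i) (hP' i)
  obtain ⟨h₂, e₂⟩ := E.interp_enc (Q' i) (hQ' i)
  -- Equal semantics have equal actions, so each premise holds under `E.decode`.
  refine e₁.trans (Eq.trans ?_ e₂.symm)
  simp only [hsem i]
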